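/- Let $X$ be a real Hilbert space with inner product $\langle\cdot,\cdot\rangle$, and let $X\times X$ carry the product Hilbert space structure. For a function $f\colon X\times X\to[-\infty,+\infty]$ let $\partial f(u)$ be the set of all $v\in X\times X$ with $f(w)\ge f(u)+\langle w-u,v\rangle$ for all $w\in X\times X$ if $f(u)$ is finite, and $\partial f(u)=\varnothing$ otherwise. For a set-valued operator $A\colon X\rightrightarrows X$ with graph $\operatorname{gra}A=\{(x,x^*)\in X\times X : x^*\in Ax\}$, let $$\Phi_A(x,x^*)=\sup_{(a,a^*)\in\operatorname{gra}A}\big(\langle x,a^*\rangle+\langle a,x^*\rangle-\langle a,a^*\rangle\big)$$ be its Fitzpatrick function, let $$\Phi_A^*(y^*,y)=\sup_{(x,x^*)\in X\times X}\big(\langle x,y^*\rangle+\langle y,x^*\rangle-\Phi_A(x,x^*)\big)$$ be the Fenchel conjugate of $\Phi_A$, and let $$\Psi_A(x,x^*)=\inf\Big(\tfrac12\Phi_A(y,y^*)+\tfrac12\Phi_A^*(z^*,z)+\tfrac18\big(\|y-z\|^2+\|y^*-z^*\|^2\big)\Big),$$ where the infimum is over all $(y,y^*),(z,z^*)\in X\times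 X$ with $(x,x^*)=\tfrac12(y+z,y^*+z^*)$ (with the convention $-\infty+\infty=-\infty$, which matters only if $\operatorname{gra}A=\varnothing$). The proximal-average extension $\widetilde A\colon X\rightrightarrows X$ of $A$ is defined by $$\operatorname{gra}\widetilde A=\{(x,x^*)\in X\times X : (x^*,x)\in\partial\Psi_A(x,x^*)\}.$$ **Theorem.** Let $A\colon X\rightrightarrows X$ be monotone, i.e. $\langle x-y,x^*-y^*\rangle\ge 0$ for all $(x,x^*),(y,y^*)\in\operatorname{gra}A$. Define $B\colon X\rightrightarrows X$ by: $x^*\in Bx$ if and only if there are $x_1,x_1^*,x_2,x_2^*\in X$ such that $$(x,x^*)=\tfrac12(x_1+x_2,\,x_1^*+x_2^*),\qquad (x_2^*,x_2)\in\partial\Phi_A(x_1,x_1^*),\qquad x_1-x_2=x_1^*-x_2^*.$$ Then $B=\widetilde A$. -/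

import Mathlib

noncomputable section

namespace ProxExt

open scoped RealInnerProductSpace

variable {X : Type*} [NormedAddCommGroup X] [InnerProductSpace ℝ X]

/-- The graph of a set-valued operator `A : X ⇉ X`. -/
def graph (A : X → Set X) : Set (X × X) := {p | p.2 ∈ A p.1}

/-- Monotonicity of a set-valued operator. -/
def IsMonotone (A : X → Set X) : Prop :=
  ∀ p ∈ graph A, ∀ q ∈ graph A, 0 ≤ ⟪p.1 - q.1, p.2 - q.2⟫

/-- The inner product of the Hilbert product space `X × X`,
`⟨(x, y), (u, v)⟩ = ⟨x, u⟩ + ⟨y, v⟩`. -/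
def pairing (p q : X × X) : ℝ := ⟪p.1, q.1⟫ + ⟪p.2, q.2⟫

/-- The Fitzpatrick function
`Φ_A (x, x*) = sup {⟨x, a*⟩ + ⟨a, x*⟩ - ⟨a, a*⟩ | (a, a*) ∈ gra A}`, with values in `[-∞, ∞]`. -/
def fitzpatrick (A : X → Set X) (p : X × X) : EReal :=
  ⨆ a ∈ graph A, ((⟪p.1, a.2⟫ + ⟪a.1, p.2⟫ - ⟪a.1, a.2⟫ : ℝ) : EReal)

/-- The Fenchel conjugate of an extended-real-valued function on the Hilbert product space
`X × X`. -/
def conjugate (f : X × X → EReal) (q : X × X) : EReal :=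
  ⨆ p : X × X, ((pairing p q : ℝ) : EReal) - f p

/-- The subdifferential of an extended-real-valued function on the Hilbert product space `X × X`;
it is empty at points where the function is not finite. -/
def subdifferential (f : X × X → EReal) (p : X × X) : Set (X × X) :=
  {q | f p ≠ ⊥ ∧ f p ≠ ⊤ ∧ ∀ r : X × X, f p + ((pairing (r - p) q : ℝ) : EReal) ≤ f r}

/-- The proximal average `Ψ_A` between `Φ_A` and the transpose of its conjugate: the infimum
over all decompositions `(x, x*) = ½ (y + z, y* + z*)` of
`½ Φ_A (y, y*) + ½ Φ_A^* (z*, z) + ⅛ (‖y - z‖² + ‖y* - z*‖²)`. -/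
def proximalAverage (A : X → Set X) (p : X × X) : EReal :=
  ⨅ (y : X × X) (z : X × X) (_ : p = (1 / 2 : ℝ) • (y + z)),
    ((1 / 2 : ℝ) : EReal) * fitzpatrick A y
      + ((1 / 2 : ℝ) : EReal) * conjugate (fitzpatrick A) (z.2, z.1)
      + ((1 / 8 * (‖y.1 - z.1‖ ^ 2 + ‖y.2 - z.2‖ ^ 2) : ℝ) : EReal)

/-- The proximal-average extension `Ã`, with
`gra Ã = {(x, x*) | (x*, x) ∈ ∂Ψ_A (x, x*)}`. -/
def extension (A : X → Set X) (x : X) : Set X :=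
  {xs | (xs, x) ∈ subdifferential (proximalAverage A) (x, xs)}

end ProxExt

end

/-! Let `F` be a closed convex function on a Hilbert space, let `J` be an isometric linear
involution of that space (the transposition, when the space is `X × X`), and let `Ψ` be the proximal
average of `F` and `F* ∘ J`. The Fenchel-Young inequality and polarization give `½⟪p, J p⟫ ≤ Ψ p`.

If `J v ∈ ∂F u` and `u - v` is fixed by `J`, then `½⟪p, J p⟫` bounds both `Ψ p` and `Ψ* (J p)` at
`p = ½(u + v)`, so that `J p ∈ ∂Ψ p`.

Conversely, let `J p ∈ ∂Ψ p`. If `p = ½(u + v)`, `J v ∈ ∂F u` and `J (u - v) = u - v`, then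
`p + J p - u = J v ∈ ∂F u`, so `u` can only be the proximal point of `p + J p`. Taking `u` to be
this point and testing the subgradient inequality of `Ψ` with the decomposition into `u` and
`J (p + J p - u)` yields `‖(u - p) - J (u - p)‖² ≤ 0`, and `v = 2 p - u` is the other half. -/

namespace ProxExt

open scoped RealInnerProductSpace
open Filter Topology

section Conjugate

variable {H : Type*} [NormedAddCommGroup H] [InnerProductSpace ℝ H]

/-- The Fenchel conjugate of an extended-real-valued function on an inner product space; it serves
the function `conjugate` on `X × X` through the identification with `WithLp 2 (X × X)`. -/
noncomputable def fenchelConjugate (f : H → EReal) (v : H) : EReal :=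
  ⨆ x, ((⟪x, v⟫ : ℝ) : EReal) - f x

/-- `v` is a subgradient of `f` at `x`, which includes that `f x` is finite. -/
def HasSubgradientAt (f : H → EReal) (v x : H) : Prop :=
  f x ≠ ⊥ ∧ f x ≠ ⊤ ∧ ∀ y, f x + ((⟪y - x, v⟫ : ℝ) : EReal) ≤ f y

/-- Closed convex functions in the sense of Fenchel-Moreau: those which equal their biconjugate.
The constants `⊥` and `⊤` are included. -/
def IsFenchelClosed (f : H → EReal) : Prop :=
  fenchelConjugate (fenchelConjugate f) = f

theorem fenchelConjugate_le_coe_iff {f : H → EReal} {v : H} {c : ℝ} :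
    fenchelConjugate f v ≤ (c : EReal) ↔
      ∀ (x : H) (s : ℝ), f x ≤ (s : EReal) → ⟪x, v⟫ - s ≤ c := by
  rw [fenchelConjugate, iSup_le_iff]
  refine forall_congr' fun x => ⟨fun h s hs => ?_, fun h => ?_⟩
  · exact_mod_cast (EReal.sub_le_sub le_rfl hs).trans h
  · induction hx : f x with
    | bot =>
      have := h (⟪x, v⟫ - c - 1) (hx ▸ bot_le)
      linarith
    | top => simp
    | coe s => exact_mod_cast h s hx.le

theorem inner_le_add_of_fenchelConjugate_le {f : H → EReal} {x v : H} {s t : ℝ}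
    (hs : f x ≤ (s : EReal)) (ht : fenchelConjugate f v ≤ (t : EReal)) : ⟪x, v⟫ ≤ s + t := by
  linarith [fenchelConjugate_le_coe_iff.1 ht x s hs]

theorem ne_bot_of_fenchelConjugate_le {f : H → EReal} {v : H} {t : ℝ}
    (ht : fenchelConjugate f v ≤ (t : EReal)) (x : H) : f x ≠ ⊥ := by
  intro hx
  have := inner_le_add_of_fenchelConjugate_le (s := ⟪x, v⟫ - t - 1) (hx ▸ bot_le) ht
  linarith

theorem hasSubgradientAt_iff_fenchelConjugate_le {f : H → EReal} {v x : H} :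
    HasSubgradientAt f v x ↔
      ∃ s : ℝ, f x ≤ (s : EReal) ∧ fenchelConjugate f v ≤ ((⟪x, v⟫ - s : ℝ) : EReal) := by
  constructor
  · rintro ⟨hbot, htop, h⟩
    lift f x to ℝ using ⟨htop, hbot⟩ with s
    refine ⟨s, le_rfl, fenchelConjugate_le_coe_iff.2 fun y t ht => ?_⟩
    have hy : s + ⟪y - x, v⟫ ≤ t := by exact_mod_cast (h y).trans ht
    rw [inner_sub_left] at hy
    linarith
  · rintro ⟨s, hs, hv⟩
    refine ⟨ne_bot_of_fenchelConjugate_le hv x, ne_top_of_le_ne_top (EReal.coe_ne_top s) hs,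
      fun y => EReal.le_of_forall_lt_iff_le.1 fun t ht => ?_⟩
    have hy : s + ⟪y - x, v⟫ ≤ t := by
      rw [inner_sub_left]
      linarith [inner_le_add_of_fenchelConjugate_le ht.le hv]
    exact (add_le_add_left hs _).trans (by exact_mod_cast hy)

theorem isFenchelClosed_iSup_affine {ι : Type*} (a : ι → H) (β : ι → ℝ) :
    IsFenchelClosed fun x => ⨆ i, ((⟪x, a i⟫ - β i : ℝ) : EReal) := by
  funext x
  refine le_antisymm (EReal.le_of_forall_lt_iff_le.1 fun c hc => ?_) (iSup_le fun i => ?_)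
  · refine fenchelConjugate_le_coe_iff.2 fun v t ht => ?_
    rw [real_inner_comm]
    have : ⟪x, v⟫ ≤ c + t := inner_le_add_of_fenchelConjugate_le hc.le ht
    linarith
  · have hconj : fenchelConjugate (fun x => ⨆ i, ((⟪x, a i⟫ - β i : ℝ) : EReal)) (a i)
        ≤ (β i : EReal) := by
      refine fenchelConjugate_le_coe_iff.2 fun y s hs => ?_
      have := EReal.coe_le_coe_iff.1 (iSup_le_iff.1 hs i)
      linarith
    refine EReal.le_of_forall_lt_iff_le.1 fun c hc => EReal.coe_le_coe_iff.2 ?_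
    have := fenchelConjugate_le_coe_iff.1 hc.le _ _ hconj
    rwa [real_inner_comm] at this

namespace IsFenchelClosed

variable {f : H → EReal}

theorem le_coe_iff (hf : IsFenchelClosed f) {x : H} {c : ℝ} :
    f x ≤ (c : EReal) ↔
      ∀ (v : H) (t : ℝ), fenchelConjugate f v ≤ (t : EReal) → ⟪x, v⟫ - t ≤ c := by
  simp only [← congrFun hf x, fenchelConjugate_le_coe_iff (v := x), real_inner_comm]

theorem exists_fenchelConjugate_le (hf : IsFenchelClosed f) {x : H} (hx : f x ≠ ⊥) :
    ∃ (v : H) (t : ℝ), fenchelConjugate f v ≤ (t : EReal) := by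
  by_contra! h
  refine hx ((EReal.eq_bot_iff_forall_lt _).2 fun c => ?_)
  refine lt_of_le_of_lt (hf.le_coe_iff.2 fun v t ht => absurd ht (h v t).not_ge)
    (EReal.coe_lt_coe_iff.2 (sub_one_lt c))

theorem epigraph_eq_iInter (hf : IsFenchelClosed f) : {q : H × ℝ | f q.1 ≤ (q.2 : EReal)} =
    ⋂ (b : H × ℝ) (_ : fenchelConjugate f b.1 ≤ (b.2 : EReal)),
      {q : H × ℝ | ⟪q.1, b.1⟫ - q.2 ≤ b.2} := by
  ext q
  simp only [Set.mem_ofPred_eq, Set.mem_iInter, hf.le_coe_iff, Prod.forall, sub_le_comm]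

theorem isClosed_epigraph (hf : IsFenchelClosed f) :
    IsClosed {q : H × ℝ | f q.1 ≤ (q.2 : EReal)} := by
  rw [hf.epigraph_eq_iInter]
  exact isClosed_biInter fun b _ => isClosed_le (by fun_prop) continuous_const

theorem convex_epigraph (hf : IsFenchelClosed f) :
    Convex ℝ {q : H × ℝ | f q.1 ≤ (q.2 : EReal)} := by
  rw [hf.epigraph_eq_iInter]
  refine convex_iInter₂ fun b _ => convex_halfSpace_le ⟨fun q r => ?_, fun c q => ?_⟩ _
  · simp only [Prod.fst_add, Prod.snd_add, inner_add_left]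
    ring
  · simp only [Prod.smul_fst, Prod.smul_snd, real_inner_smul_left, smul_eq_mul]
    ring

end IsFenchelClosed

end Conjugate

section ProximalPoint

variable {H : Type*} [NormedAddCommGroup H] [InnerProductSpace ℝ H]

/-- The function `s + ½‖x - w‖²` of a point `(x, s)` of `H × ℝ`. Its minimizer over the epigraph of
a closed convex function lies over the proximal point of `w`. -/
noncomputable def proxObjective (w : H) (q : H × ℝ) : ℝ := q.2 + 1 / 2 * ‖q.1 - w‖ ^ 2

theorem proxObjective_add_smul_sub (w : H) (q r : H × ℝ) (t : ℝ) :
    proxObjective w (q + t • (r - q)) = proxObjective w q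
      + t * (r.2 - q.2 - ⟪r.1 - q.1, w - q.1⟫) + t ^ 2 * (1 / 2 * ‖r.1 - q.1‖ ^ 2) := by
  have hfst : (q + t • (r - q)).1 - w = t • (r.1 - q.1) - (w - q.1) := by
    simp only [Prod.fst_add, Prod.smul_fst, Prod.fst_sub]
    abel
  rw [proxObjective, proxObjective, hfst, norm_sub_sq_real, norm_smul, mul_pow, Real.norm_eq_abs,
    sq_abs, real_inner_smul_left, norm_sub_rev w]
  simp only [Prod.snd_add, Prod.smul_snd, Prod.snd_sub, smul_eq_mul]
  ring

theorem norm_sq_sub_le_of_le_proxObjective {E : Set (H × ℝ)} (hE : Convex ℝ E) {w : H} {m : ℝ}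
    (hm : ∀ q ∈ E, m ≤ proxObjective w q) {q r : H × ℝ} (hq : q ∈ E) (hr : r ∈ E) :
    ‖q.1 - r.1‖ ^ 2 ≤ 4 * ((proxObjective w q - m) + (proxObjective w r - m)) := by
  have hmid := hm _ (hE.add_smul_sub_mem hq hr (t := 1 / 2) ⟨by norm_num, by norm_num⟩)
  have hend := proxObjective_add_smul_sub w q r 1
  rw [proxObjective_add_smul_sub] at hmid
  rw [one_smul, add_sub_cancel] at hend
  rw [norm_sub_rev]
  linarith

theorem exists_isMinOn_proxObjective [CompleteSpace H] {E : Set (H × ℝ)} (hE : Convex ℝ E)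
    (hclosed : IsClosed E) (hne : E.Nonempty) {w : H} (hbdd : BddBelow (proxObjective w '' E)) :
    ∃ q ∈ E, IsMinOn (proxObjective w) E q := by
  set m := sInf (proxObjective w '' E)
  have hm : ∀ q ∈ E, m ≤ proxObjective w q := fun q hq => csInf_le hbdd ⟨q, hq, rfl⟩
  obtain ⟨φ, hanti, hφ, hmem⟩ := exists_seq_tendsto_sInf (hne.image _) hbdd
  choose q hqE hqφ using hmem
  have hcauchy : CauchySeq fun n => (q n).1 := by
    refine cauchySeq_of_le_tendsto_0 (fun n => √(8 * (φ n - m))) (fun i j N hi hj => ?_) ?_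
    · rw [dist_eq_norm]
      refine Real.le_sqrt_of_sq_le ?_
      have := norm_sq_sub_le_of_le_proxObjective hE hm (hqE i) (hqE j)
      rw [hqφ, hqφ] at this
      linarith [hanti hi, hanti hj]
    · have hlim : Tendsto (fun n => √(8 * (φ n - m))) atTop (𝓝 √(8 * (m - m))) :=
        ((hφ.sub_const m).const_mul 8).sqrt
      simpa using hlim
  obtain ⟨u, hu⟩ := cauchySeq_tendsto_of_complete hcauchy
  have hsnd : Tendsto (fun n => (q n).2) atTop (𝓝 (m - 1 / 2 * ‖u - w‖ ^ 2)) := by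
    refine (hφ.sub (((hu.sub_const w).norm.pow 2).const_mul (1 / 2))).congr fun n => ?_
    rw [← hqφ n, proxObjective, add_sub_cancel_right]
  refine ⟨_, hclosed.mem_of_tendsto (hu.prodMk_nhds hsnd) (Eventually.of_forall hqE),
    fun r hr => (hm r hr).trans' ?_⟩
  simp [proxObjective]

theorem add_inner_le_of_isMinOn_proxObjective {E : Set (H × ℝ)} (hE : Convex ℝ E) {w : H}
    {q r : H × ℝ} (hq : q ∈ E) (hmin : IsMinOn (proxObjective w) E q) (hr : r ∈ E) :
    q.2 + ⟪r.1 - q.1, w - q.1⟫ ≤ r.2 := by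
  have hslope : ∀ t ∈ Set.Ioc (0 : ℝ) 1,
      q.2 + ⟪r.1 - q.1, w - q.1⟫ ≤ r.2 + t * (1 / 2 * ‖r.1 - q.1‖ ^ 2) := by
    rintro t ⟨ht0, ht1⟩
    have h := isMinOn_iff.1 hmin _ (hE.add_smul_sub_mem hq hr ⟨ht0.le, ht1⟩)
    rw [proxObjective_add_smul_sub] at h
    refine le_of_mul_le_mul_left ?_ ht0
    linarith
  have hlim : Tendsto (fun t : ℝ => r.2 + t * (1 / 2 * ‖r.1 - q.1‖ ^ 2)) (𝓝[>] 0) (𝓝 r.2) :=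
    tendsto_nhdsWithin_of_tendsto_nhds (Continuous.tendsto' (by fun_prop) _ _ (by simp))
  exact ge_of_tendsto hlim (eventually_of_mem (Ioc_mem_nhdsGT one_pos) hslope)

theorem bddBelow_proxObjective_epigraph {f : H → EReal} {v : H} {t : ℝ}
    (ht : fenchelConjugate f v ≤ (t : EReal)) (w : H) :
    BddBelow (proxObjective w '' {q : H × ℝ | f q.1 ≤ (q.2 : EReal)}) := by
  refine ⟨⟪w, v⟫ - 1 / 2 * ‖v‖ ^ 2 - t, ?_⟩
  rintro _ ⟨q, hq, rfl⟩
  have hFY : ⟪q.1, v⟫ ≤ q.2 + t := inner_le_add_of_fenchelConjugate_le hq ht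
  have hsq := norm_add_sq_real (q.1 - w) v
  rw [inner_sub_left] at hsq
  rw [proxObjective]
  linarith [sq_nonneg ‖q.1 - w + v‖]

theorem IsFenchelClosed.exists_hasSubgradientAt_sub [CompleteSpace H] {f : H → EReal}
    (hf : IsFenchelClosed f) {x y : H} (hx : f x ≠ ⊥) (hy : f y ≠ ⊤) (w : H) :
    ∃ u, HasSubgradientAt f (w - u) u := by
  obtain ⟨v, t, ht⟩ := hf.exists_fenchelConjugate_le hx
  obtain ⟨q, hq, hmin⟩ := exists_isMinOn_proxObjective hf.convex_epigraph hf.isClosed_epigraph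
    ⟨(y, (f y).toReal), EReal.le_coe_toReal hy⟩ (bddBelow_proxObjective_epigraph ht w)
  refine ⟨q.1, hasSubgradientAt_iff_fenchelConjugate_le.2
    ⟨q.2, hq, fenchelConjugate_le_coe_iff.2 fun y s hs => ?_⟩⟩
  have := add_inner_le_of_isMinOn_proxObjective hf.convex_epigraph hq hmin (r := (y, s)) hs
  rw [inner_sub_left] at this
  linarith

end ProximalPoint

section ProximalAverage

variable {H : Type*} [NormedAddCommGroup H] [InnerProductSpace ℝ H]

/-- The proximal average of two functions, as in `proximalAverage` but for an arbitrary pair of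
functions on an inner product space, and with the same convention `⊥ + ⊤ = ⊥`. -/
noncomputable def proxAverage (f g : H → EReal) (p : H) : EReal :=
  ⨅ (y : H) (z : H) (_ : p = (1 / 2 : ℝ) • (y + z)),
    ((1 / 2 : ℝ) : EReal) * f y + ((1 / 2 : ℝ) : EReal) * g z
      + ((1 / 8 * ‖y - z‖ ^ 2 : ℝ) : EReal)

theorem proxAverage_half_add_le {f g : H → EReal} {y z : H} {s t : ℝ} (hs : f y ≤ (s : EReal))
    (ht : g z ≤ (t : EReal)) :
    proxAverage f g ((1 / 2 : ℝ) • (y + z))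
      ≤ ((1 / 2 * s + 1 / 2 * t + 1 / 8 * ‖y - z‖ ^ 2 : ℝ) : EReal) := by
  have hhalf : (0 : EReal) ≤ ((1 / 2 : ℝ) : EReal) := EReal.coe_nonneg.2 (by norm_num)
  refine (iInf_le_of_le y <| iInf_le_of_le z <| iInf_le _ rfl).trans ?_
  rw [EReal.coe_add, EReal.coe_add, EReal.coe_mul, EReal.coe_mul]
  exact add_le_add_left (add_le_add (mul_le_mul_of_nonneg_left hs hhalf)
    (mul_le_mul_of_nonneg_left ht hhalf)) _

theorem coe_le_proxAverage {f g : H → EReal} (hf : ∀ y, f y ≠ ⊥) (hg : ∀ z, g z ≠ ⊥) {p : H}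
    {c : ℝ}
    (h : ∀ (y z : H) (s t : ℝ), p = (1 / 2 : ℝ) • (y + z) → f y ≤ (s : EReal) →
      g z ≤ (t : EReal) → c ≤ 1 / 2 * s + 1 / 2 * t + 1 / 8 * ‖y - z‖ ^ 2) :
    (c : EReal) ≤ proxAverage f g p := by
  have hhalf : (0 : ℝ) < 1 / 2 := by norm_num
  refine le_iInf fun y => le_iInf fun z => le_iInf fun hp => ?_
  induction hy : f y with
  | bot => exact absurd hy (hf y)
  | top =>
    have hz : ((1 / 2 : ℝ) : EReal) * g z ≠ ⊥ := by
      simp [EReal.mul_eq_bot, hg z]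
    rw [EReal.coe_mul_top_of_pos hhalf, EReal.top_add_of_ne_bot hz, EReal.top_add_coe]
    exact le_top
  | coe s =>
    induction hz : g z with
    | bot => exact absurd hz (hg z)
    | top =>
      rw [EReal.coe_mul_top_of_pos hhalf, ← EReal.coe_mul, EReal.coe_add_top, EReal.top_add_coe]
      exact le_top
    | coe t => exact_mod_cast h y z s t hp hy.le hz.le

theorem ne_bot_of_proxAverage_ne_bot {f g : H → EReal} {p : H} (h : proxAverage f g p ≠ ⊥) :
    (∀ y, f y ≠ ⊥) ∧ ∀ z, g z ≠ ⊥ := by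
  have hhalf : (0 : ℝ) < 1 / 2 := by norm_num
  refine ⟨fun y hy => h (le_bot_iff.1 ?_), fun z hz => h (le_bot_iff.1 ?_)⟩
  · refine iInf_le_of_le y <| iInf_le_of_le ((2 : ℝ) • p - y) <| iInf_le_of_le (by module) ?_
    rw [hy, EReal.coe_mul_bot_of_pos hhalf, EReal.bot_add, EReal.bot_add]
  · refine iInf_le_of_le ((2 : ℝ) • p - z) <| iInf_le_of_le z <| iInf_le_of_le (by module) ?_
    rw [hz, EReal.coe_mul_bot_of_pos hhalf, EReal.add_bot, EReal.bot_add]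

theorem inner_half_add_half_add (y z a b : H) :
    ⟪(1 / 2 : ℝ) • (y + z), (1 / 2 : ℝ) • (a + b)⟫
      = 1 / 2 * ⟪y, a⟫ + 1 / 2 * ⟪z, b⟫ - 1 / 4 * ⟪y - z, a - b⟫ := by
  simp only [real_inner_smul_left, real_inner_smul_right, inner_add_left, inner_add_right,
    inner_sub_left, inner_sub_right]
  ring

theorem fenchelConjugate_proxAverage_half_add_le {f g : H → EReal} {a b : H} {s t : ℝ}
    (hs : fenchelConjugate f a ≤ (s : EReal)) (ht : fenchelConjugate g b ≤ (t : EReal)) :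
    fenchelConjugate (proxAverage f g) ((1 / 2 : ℝ) • (a + b))
      ≤ ((1 / 2 * s + 1 / 2 * t + 1 / 8 * ‖a - b‖ ^ 2 : ℝ) : EReal) := by
  refine fenchelConjugate_le_coe_iff.2 fun p c hc => ?_
  rw [sub_le_comm, ← EReal.coe_le_coe_iff]
  refine hc.trans' (coe_le_proxAverage (ne_bot_of_fenchelConjugate_le hs)
    (ne_bot_of_fenchelConjugate_le ht) fun y z s' t' hp hy hz => ?_)
  have hya := inner_le_add_of_fenchelConjugate_le hy hs
  have hzb := inner_le_add_of_fenchelConjugate_le hz ht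
  have hsq := norm_add_sq_real (y - z) (a - b)
  rw [hp, inner_half_add_half_add]
  linarith [sq_nonneg ‖y - z + (a - b)‖]

end ProximalAverage

section Involution

variable {H : Type*} [NormedAddCommGroup H] [InnerProductSpace ℝ H] {J : H ≃ₗᵢ[ℝ] H}

theorem inner_map_left_of_involutive (hJ : Function.Involutive J) (x y : H) :
    ⟪J x, y⟫ = ⟪x, J y⟫ := by
  rw [← J.inner_map_map, hJ]

theorem map_half_add_comm (y z : H) :
    J ((1 / 2 : ℝ) • (y + z)) = (1 / 2 : ℝ) • (J z + J y) := by
  rw [map_smul, map_add, add_comm]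

theorem inner_half_add_map_half_add (hJ : Function.Involutive J) (y z : H) :
    ⟪(1 / 2 : ℝ) • (y + z), J ((1 / 2 : ℝ) • (y + z))⟫
      = ⟪y, J z⟫ + 1 / 4 * ⟪y - z, J (y - z)⟫ := by
  have hsymm : ⟪z, J y⟫ = ⟪y, J z⟫ := by
    rw [← inner_map_left_of_involutive hJ, real_inner_comm]
  rw [map_half_add_comm, inner_half_add_half_add, hsymm, ← map_sub, ← neg_sub y z, map_neg,
    inner_neg_right]
  ring

theorem half_inner_map_le_proxAverage (hJ : Function.Involutive J) {f : H → EReal}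
    (hf : ∀ y, f y ≠ ⊥) (hconj : ∀ v, fenchelConjugate f v ≠ ⊥) (p : H) :
    ((1 / 2 * ⟪p, J p⟫ : ℝ) : EReal) ≤ proxAverage f (fenchelConjugate f ∘ J) p := by
  refine coe_le_proxAverage hf (fun z => hconj (J z)) fun y z s t hp hs ht => ?_
  have hFY : ⟪y, J z⟫ ≤ s + t := inner_le_add_of_fenchelConjugate_le hs ht
  have hCS : ⟪y - z, J (y - z)⟫ ≤ ‖y - z‖ ^ 2 := by
    simpa only [J.norm_map, sq] using real_inner_le_norm (y - z) (J (y - z))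
  rw [hp, inner_half_add_map_half_add hJ]
  linarith

theorem fenchelConjugate_comp_fenchelConjugate_le (hJ : Function.Involutive J) {f : H → EReal}
    {x : H} {s : ℝ} (hs : f x ≤ (s : EReal)) :
    fenchelConjugate (fenchelConjugate f ∘ J) (J x) ≤ (s : EReal) := by
  refine fenchelConjugate_le_coe_iff.2 fun z t ht => ?_
  rw [← inner_map_left_of_involutive hJ, real_inner_comm]
  linarith [inner_le_add_of_fenchelConjugate_le hs ht]

theorem HasSubgradientAt.proxAverage_half_add (hJ : Function.Involutive J) {f : H → EReal} {u v : H}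
    (h : HasSubgradientAt f (J v) u) (huv : J (u - v) = u - v) :
    HasSubgradientAt (proxAverage f (fenchelConjugate f ∘ J))
      (J ((1 / 2 : ℝ) • (u + v))) ((1 / 2 : ℝ) • (u + v)) := by
  obtain ⟨s, hs, hconj⟩ := hasSubgradientAt_iff_fenchelConjugate_le.1 h
  have hval := inner_half_add_map_half_add hJ u v
  rw [huv, real_inner_self_eq_norm_sq] at hval
  have hnorm : ‖J v - J u‖ = ‖u - v‖ := by rw [← map_sub, J.norm_map, norm_sub_rev]
  refine hasSubgradientAt_iff_fenchelConjugate_le.2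
    ⟨_, proxAverage_half_add_le (g := fenchelConjugate f ∘ J) hs hconj, ?_⟩
  rw [hval, map_half_add_comm]
  refine (fenchelConjugate_proxAverage_half_add_le hconj
    (fenchelConjugate_comp_fenchelConjugate_le hJ hs)).trans (EReal.coe_le_coe_iff.2 ?_)
  rw [hnorm]
  linarith

theorem map_sub_eq_of_hasSubgradientAt_proxAverage (hJ : Function.Involutive J) {f : H → EReal}
    {p u : H} (hp : HasSubgradientAt (proxAverage f (fenchelConjugate f ∘ J)) (J p) p)
    (hu : HasSubgradientAt f (p + J p - u) u) : J (u - p) = u - p := by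
  obtain ⟨hf, hconj⟩ := ne_bot_of_proxAverage_ne_bot hp.1
  obtain ⟨c, hc, hΨ⟩ := hasSubgradientAt_iff_fenchelConjugate_le.1 hp
  obtain ⟨s, hs, hq⟩ := hasSubgradientAt_iff_fenchelConjugate_le.1 hu
  have hlower : 1 / 2 * ⟪p, J p⟫ ≤ c := EReal.coe_le_coe_iff.1 <|
    (half_inner_map_le_proxAverage hJ hf (fun v => hJ v ▸ hconj (J v)) p).trans hc
  obtain ⟨d, rfl⟩ : ∃ d, u = p + d := ⟨u - p, (add_sub_cancel p u).symm⟩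
  have hJz : J (p - J d) = p + J p - (p + d) := by
    rw [map_sub, hJ]
    abel
  have hz : (fenchelConjugate f ∘ J) (p - J d)
      ≤ ((⟪p + d, p + J p - (p + d)⟫ - s : ℝ) : EReal) := by
    rwa [Function.comp_apply, hJz]
  have htest := inner_le_add_of_fenchelConjugate_le (proxAverage_half_add_le hs hz) hΨ
  have hdiff : p + d - (p - J d) = d + J d := by abel
  rw [hdiff, norm_add_sq_real, J.norm_map] at htest
  have hsq : ‖d - J d‖ ^ 2 ≤ 0 := by
    rw [norm_sub_sq_real, J.norm_map]
    simp only [real_inner_smul_left, inner_add_left, inner_add_right, inner_sub_left,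
      inner_sub_right, J.inner_map_map, real_inner_self_eq_norm_sq, real_inner_comm p d] at htest
    linarith
  have hzero : d - J d = 0 := by
    simpa using hsq.antisymm (sq_nonneg _)
  rw [add_sub_cancel_left, ← sub_eq_zero.1 hzero]

theorem exists_of_hasSubgradientAt_proxAverage [CompleteSpace H] (hJ : Function.Involutive J)
    {f : H → EReal} (hf : IsFenchelClosed f) {p : H}
    (hp : HasSubgradientAt (proxAverage f (fenchelConjugate f ∘ J)) (J p) p) :
    ∃ u v, p = (1 / 2 : ℝ) • (u + v) ∧ HasSubgradientAt f (J v) u ∧ J (u - v) = u - v := by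
  obtain ⟨hbot, hconj⟩ := ne_bot_of_proxAverage_ne_bot hp.1
  obtain ⟨y, hy⟩ : ∃ y, f y ≠ ⊤ := by
    by_contra! htop
    exact hconj p (by simp [fenchelConjugate, htop])
  obtain ⟨u, hu⟩ := hf.exists_hasSubgradientAt_sub (hbot y) hy (p + J p)
  have hfix := map_sub_eq_of_hasSubgradientAt_proxAverage hJ hp hu
  refine ⟨u, (2 : ℝ) • p - u, by module, ?_, ?_⟩
  · have hJv : J ((2 : ℝ) • p - u) = p + J p - u := by
      rw [show (2 : ℝ) • p - u = p - (u - p) by module, map_sub, hfix]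
      abel
    rwa [hJv]
  · rw [show u - ((2 : ℝ) • p - u) = (2 : ℝ) • (u - p) by module, map_smul, hfix]

theorem hasSubgradientAt_proxAverage_iff [CompleteSpace H] (hJ : Function.Involutive J)
    {f : H → EReal} (hf : IsFenchelClosed f) {p : H} :
    HasSubgradientAt (proxAverage f (fenchelConjugate f ∘ J)) (J p) p ↔
      ∃ u v, p = (1 / 2 : ℝ) • (u + v) ∧ HasSubgradientAt f (J v) u ∧ J (u - v) = u - v :=
  ⟨exists_of_hasSubgradientAt_proxAverage hJ hf,
    fun ⟨_, _, hp, h, huv⟩ => hp ▸ h.proxAverage_half_add hJ huv⟩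

end Involution

section Product

variable {X : Type*} [NormedAddCommGroup X] [InnerProductSpace ℝ X]

open WithLp LinearIsometryEquiv

theorem withLpProdComm_involutive : Function.Involutive (withLpProdComm 2 ℝ X X) :=
  fun _ => rfl

theorem mem_subdifferential_iff_hasSubgradientAt {f : X × X → EReal} {p q : X × X} :
    q ∈ subdifferential f p ↔ HasSubgradientAt (f ∘ ofLp) (toLp 2 q) (toLp 2 p) :=
  and_congr Iff.rfl <| and_congr Iff.rfl <| ((toLp_surjective 2).forall (p := fun y =>
    f p + ((⟪y - toLp 2 p, toLp 2 q⟫ : ℝ) : EReal) ≤ f (ofLp y))).symm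

theorem conjugate_eq_fenchelConjugate (f : X × X → EReal) (q : X × X) :
    conjugate f q = fenchelConjugate (f ∘ ofLp) (toLp 2 q) :=
  (toLp_surjective 2).iSup_comp fun y => ((⟪y, toLp 2 q⟫ : ℝ) : EReal) - f (ofLp y)

theorem isFenchelClosed_fitzpatrick (A : X → Set X) :
    IsFenchelClosed (fitzpatrick A ∘ ofLp (p := 2)) := by
  have := isFenchelClosed_iSup_affine (fun a : graph A => toLp 2 (a : X × X).swap)
    fun a => ⟪(a : X × X).1, (a : X × X).2⟫
  convert this using 2 with p
  simp [fitzpatrick, iSup_subtype', real_inner_comm]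

theorem proximalAverage_comp_ofLp (A : X → Set X) :
    proximalAverage A ∘ ofLp = proxAverage (fitzpatrick A ∘ ofLp)
      (fenchelConjugate (fitzpatrick A ∘ ofLp) ∘ withLpProdComm 2 ℝ X X) := by
  funext p
  simp only [Function.comp_apply, proximalAverage, proxAverage]
  rw [← (toLp_surjective 2).iInf_comp]
  refine iInf_congr fun y => ?_
  rw [← (toLp_surjective 2).iInf_comp]
  refine iInf_congr fun z => iInf_congr_Prop (ofLp_injective 2).eq_iff fun _ => ?_
  rw [conjugate_eq_fenchelConjugate, prod_norm_sq_eq_of_L2]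
  rfl

theorem mem_extension_iff [CompleteSpace X] (A : X → Set X) (x xs : X) :
    xs ∈ extension A x ↔ ∃ u v : X × X, (x, xs) = (1 / 2 : ℝ) • (u + v) ∧
      v.swap ∈ subdifferential (fitzpatrick A) u ∧ (u - v).swap = u - v := by
  rw [extension, Set.mem_ofPred_eq, mem_subdifferential_iff_hasSubgradientAt,
    proximalAverage_comp_ofLp]
  refine (hasSubgradientAt_proxAverage_iff withLpProdComm_involutive
    (isFenchelClosed_fitzpatrick A) (p := toLp 2 (x, xs))).trans ?_
  simp only [(toLp_surjective 2).exists, mem_subdifferential_iff_hasSubgradientAt]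
  refine exists₂_congr fun u v => ?_
  exact and_congr (toLp_injective 2).eq_iff (and_congr Iff.rfl (toLp_injective 2).eq_iff)

end Product

end ProxExt

theorem theorem2p10_general {X : Type*} [NormedAddCommGroup X] [InnerProductSpace ℝ X]
    [CompleteSpace X] (A : X → Set X) (B : X → Set X)
    (hB : ∀ x xs : X, xs ∈ B x ↔ ∃ x₁ x₁s x₂ x₂s : X,
      (x, xs) = (1 / 2 : ℝ) • (x₁ + x₂, x₁s + x₂s) ∧
      (x₂s, x₂) ∈ ProxExt.subdifferential (ProxExt.fitzpatrick A) (x₁, x₁s) ∧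
      x₁ - x₂ = x₁s - x₂s) :
    B = ProxExt.extension A := by
  ext x xs
  rw [hB, ProxExt.mem_extension_iff]
  constructor
  · rintro ⟨x₁, x₁s, x₂, x₂s, hx, hsub, hd⟩
    exact ⟨(x₁, x₁s), (x₂, x₂s), hx, hsub, Prod.ext hd.symm hd⟩
  · rintro ⟨u, v, hx, hsub, hd⟩
    exact ⟨u.1, u.2, v.1, v.2, hx, hsub, congrArg Prod.snd hd⟩

theorem theorem2p10 {X : Type*} [NormedAddCommGroup X] [InnerProductSpace ℝ X] [CompleteSpace X]
    (A : X → Set X) (hA : ProxExt.IsMonotone A) (B : X → Set X)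
    (hB : ∀ x xs : X, xs ∈ B x ↔ ∃ x₁ x₁s x₂ x₂s : X,
      (x, xs) = (1 / 2 : ℝ) • (x₁ + x₂, x₁s + x₂s) ∧
      (x₂s, x₂) ∈ ProxExt.subdifferential (ProxExt.fitzpatrick A) (x₁, x₁s) ∧
      x₁ - x₂ = x₁s - x₂s) :
    B = ProxExt.extension A :=
  theorem2p10_general A B hB
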